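/- Let $q$ be a prime power, let $K=\mathbb{F}_q(T)$, and let $\phi\colon \mathbb{F}_q[T]\to \mathrm{End}_{K}(\mathbb{G}_a)$ be a Drinfeld module of rank $2$ given by $$\phi_T(x)=Tx+gx^q+\Delta x^{q^2},$$ where $g,\Delta\in\mathbb{F}_q[T]$ (so $\Delta\neq 0$). Suppose that $\phi_T(1)=T+g+\Delta$ is coprime to $T\Delta$ in $\mathbb{F}_q[T]$. Let $N$ be the least common multiple of the degrees of the irreducible divisors of $\Delta$ in $\mathbb{F}_q[T]$ ($N=1$ if $\Delta$ is constant), and let $S$ be the finite set consisting of the places of $K$ dividing $T\Delta$ and the place $v_\infty$ at infinity. For $x\in K$ and $n\ge 0$ write $\phi_{T^n}(x)=\mathfrak{A}_n/\mathfrak{B}_n$ with $\mathfrak{A}_n,\mathfrak{B}_n\in\mathbb{F}_q[T]$ coprime. A primitive divisor of $\mathfrak{A}_n$ is a prime element $\mathfrak{p}$ of $\mathbb{F}_q[T]$ such that $\mathfrak{p}\mid\mathfrak{A}_n$ and $\mathfrak{p}\nmid\mathfrak{A}_i$ for every $0\le i<n$. Put $$\mathcal{Z}(\phi,x)=\{n\ge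 1 : \mathfrak{A}_n \text{ does not have a primitive divisor}\}.$$ Let $x\in\mathbb{F}_q[T]$ be a point that is not torsion for $\phi$, that is, $\phi_a(x)\ne 0$ for every nonzero $a\in\mathbb{F}_q[T]$. Then $\mathcal{Z}(\phi,x)$ is finite, and every $n\in\mathcal{Z}(\phi,x)$ satisfies $$n\le \bigl(6(q^{2N}-1)N|S|+4\bigr)+\tfrac12\log_q\bigl(2+2\deg g+2\deg\Delta\bigr),$$ where $\deg g$ is read as $0$ if $g=0$. In other words, $\max\mathcal{Z}(\phi,x)$ is at most the right-hand side (a void claim if $\mathcal{Z}(\phi,x)$ is empty). -/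

import Mathlib

open Polynomial

/-- A polynomial `P` over `K` is additive if `P(a + b) = P(a) + P(b)` identically (`a`, `b` range
over `K[X]`). Additive polynomials, with addition and composition, form the endomorphism ring of
the additive group `G_a` over `K`. -/
def IsAdditivePolynomial {K : Type*} [Field K] (P : K[X]) : Prop :=
  ∀ a b : K[X], P.comp (a + b) = P.comp a + P.comp b

/-- A Drinfeld `F[T]`-module over `F(T)`, where `T` is the variable of `F[X]`: a ring homomorphism
`a ↦ φ_a` from `F[T]` to the endomorphism ring of `G_a` over `F(T)` (whose product is composition
of additive polynomials) such that the derivative of `φ_a` is `a`, and `φ_a` is not `a x`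
for all `a`. -/
structure DrinfeldModule (F : Type*) [Field F] where
  toFun : F[X] → (RatFunc F)[X]
  additive : ∀ a, IsAdditivePolynomial (toFun a)
  map_one : toFun 1 = X
  map_add : ∀ a b, toFun (a + b) = toFun a + toFun b
  map_mul : ∀ a b, toFun (a * b) = (toFun a).comp (toFun b)
  coeff_one : ∀ a, (toFun a).coeff 1 = algebraMap F[X] (RatFunc F) a
  nontrivial : ∃ a, toFun a ≠ C (algebraMap F[X] (RatFunc F) a) * X

namespace DrinfeldModule

variable {F : Type*} [Field F]

instance : CoeFun (DrinfeldModule F) (fun _ => F[X] → (RatFunc F)[X]) := ⟨toFun⟩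

/-- `φ` has rank `r`: the polynomial `φ_T` has degree `q ^ r`, with `q` the cardinality of `F`. -/
def HasRank (φ : DrinfeldModule F) (r : ℕ) : Prop :=
  (φ X).natDegree = Nat.card F ^ r

/-- `x` is a torsion point of `φ`: `φ_a(x) = 0` for some nonzero `a`. -/
def IsTorsion (φ : DrinfeldModule F) (x : RatFunc F) : Prop :=
  ∃ a : F[X], a ≠ 0 ∧ (φ a).eval x = 0

/-- The numerator of `φ_{T^n}(x)` written in lowest terms. -/
noncomputable def numer (φ : DrinfeldModule F) (x : RatFunc F) (n : ℕ) : F[X] :=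
  ((φ (X ^ n)).eval x).num

/-- `p` is a primitive divisor of the `n`-th numerator. -/
def IsPrimitiveDivisor (φ : DrinfeldModule F) (x : RatFunc F) (n : ℕ) (p : F[X]) : Prop :=
  Prime p ∧ p ∣ φ.numer x n ∧ ∀ i < n, ¬ p ∣ φ.numer x i

/-- The Zsigmondy set of `φ` and `x`. -/
def zsigmondySet (φ : DrinfeldModule F) (x : RatFunc F) : Set ℕ :=
  {n | 1 ≤ n ∧ ¬ ∃ p, φ.IsPrimitiveDivisor x n p}

end DrinfeldModule

/-- The places of the rational function field `F(T)`, for `F` finite: the finite places, which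
correspond to the nonzero prime ideals of `F[T]`, and the place at infinity. -/
inductive RatFuncPlace (F : Type*) [Field F] where
  | finite (v : IsDedekindDomain.HeightOneSpectrum F[X]) : RatFuncPlace F
  | infinite : RatFuncPlace F

/-- The (finite) places dividing `a`, together with the place at infinity. -/
def placesDividingOrInfinite {F : Type*} [Field F] (a : F[X]) : Set (RatFuncPlace F) :=
  {w | ∃ v : IsDedekindDomain.HeightOneSpectrum F[X],
    w = RatFuncPlace.finite v ∧ a ∈ v.asIdeal} ∪ {RatFuncPlace.infinite}

/-- The least common multiple of the degrees of the irreducible divisors of `Δ ≠ 0`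
(it is `1` if `Δ` is constant). -/
noncomputable def lcmFactorDegrees {F : Type*} [Field F] (Δ : F[X]) : ℕ :=
  ((UniqueFactorizationMonoid.factors Δ).map natDegree).lcm

/-! Write `a n = φ_{T^n}(x)`, a polynomial because `x`, `g`, `Δ` are. Then `a (n + 1) = a n * b n`
with `b n = T + g * a n ^ (q - 1) + Δ * a n ^ (q ^ 2 - 1)`, so `a 0 ∣ a 1 ∣ ⋯`, and the degrees of
the `a n` increase strictly, since `a (n + 1) = c * a n` with `c` constant would make `x` a torsion
point (`eval_X_pow_succ_ne`).

If `a (n + 1)` has no primitive divisor, each prime divisor of `b n` divides `a n`, hence also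
`T = b n - a n * (⋯)`; so `b n = c * T ^ k` with `c` constant (`exists_eq_C_mul_X_pow`), and
`a n ^ (q - 1) * (g + Δ * a n ^ (q ^ 2 - q)) = c * T ^ k - T`.

* If `k = 0`, then `deg (a n) ≤ 1`, whence `n ≤ 1`.
* If `k = 1` and `deg (a n) ≥ 2`, both sides vanish, so `g = -Δ * a n ^ (q ^ 2 - q)`. This makes `g`
  so large that `a n` could not have arisen from an element of smaller degree
  (`false_of_eq_neg_mul_pow`).
* If `k ≥ 2`, then `T ∣ a n`. As `T ∤ φ_T(1)`, the recursion modulo `T` shows that `T` already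
  divides `a (n - 1)`, so `T ^ 2 ∣ a n`, and then `T ^ 2 ∣ T`, which is absurd.

Hence the Zsigmondy set is contained in `{1, 2}`, while the asserted bound is at least `4`. -/

/-! ### Constants and the recursion -/

namespace DrinfeldModule

variable {F : Type*} [Field F]

/-- Constants act by multiplication: `φ_c` is invertible under composition, hence of degree one,
and it has no constant term because it is additive. -/
theorem toFun_C (φ : DrinfeldModule F) {c : F} (hc : c ≠ 0) :
    φ (C c) = C (algebraMap F[X] (RatFunc F) (C c)) * X := by
  have hinv : (φ (C c)).comp (φ (C c⁻¹)) = X := by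
    rw [← φ.map_mul, ← C_mul, mul_inv_cancel₀ hc, C_1, φ.map_one]
  have hdeg : (φ (C c)).natDegree ≤ 1 := by
    have h := congrArg natDegree hinv
    rw [natDegree_comp, natDegree_X] at h
    exact (Nat.eq_one_of_mul_eq_one_right h).le
  have hzero : (φ (C c)).coeff 0 = 0 := by
    have h := φ.additive (C c) 0 0
    have h' : (φ (C c)).comp 0 = 0 := by simpa using h
    rw [← C_0, comp_C, C_inj] at h'
    rwa [coeff_zero_eq_eval_zero]
  rw [eq_X_add_C_of_natDegree_le_one hdeg, hzero, φ.coeff_one]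
  simp

theorem eval_X_pow_succ (φ : DrinfeldModule F) (y : RatFunc F) (n : ℕ) :
    (φ (X ^ (n + 1))).eval y = (φ X).eval ((φ (X ^ n)).eval y) := by
  rw [pow_succ', φ.map_mul, eval_comp]

/-- For a point that is not torsion, `φ_{T^(n+1)}(y)` is not a constant multiple of
`φ_{T^n}(y)`; otherwise `φ_{(T-c)T^n}(y) = 0`. -/
theorem eval_X_pow_succ_ne (φ : DrinfeldModule F) {y : RatFunc F} (hy : ¬ φ.IsTorsion y)
    (n : ℕ) {c : F} (hc : c ≠ 0) :
    (φ (X ^ (n + 1))).eval y ≠ algebraMap F[X] (RatFunc F) (C c) * (φ (X ^ n)).eval y := by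
  intro h
  refine hy ⟨(X + C (-c)) * X ^ n, mul_ne_zero (X_add_C_ne_zero _) (pow_ne_zero _ X_ne_zero), ?_⟩
  rw [φ.map_mul, φ.map_add, φ.toFun_C (neg_ne_zero.2 hc), eval_comp, eval_add,
    ← eval_X_pow_succ, h]
  simp

theorem eval_X_pow_ne_zero (φ : DrinfeldModule F) {y : RatFunc F} (hy : ¬ φ.IsTorsion y)
    (n : ℕ) : (φ (X ^ n)).eval y ≠ 0 :=
  fun h => hy ⟨X ^ n, pow_ne_zero _ X_ne_zero, h⟩

end DrinfeldModule

/-- The quotient `φ_T(s) / s = T + g s^(q-1) + Δ s^(q^2-1)`. -/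
noncomputable def drinfeldQuotient {F : Type*} [Field F] (q : ℕ) (g Δ s : F[X]) : F[X] :=
  X + g * s ^ (q - 1) + Δ * s ^ (q ^ 2 - 1)

/-- The polynomials `φ_{T^n}(x)`. -/
noncomputable def drinfeldOrbit {F : Type*} [Field F] (q : ℕ) (g Δ x : F[X]) : ℕ → F[X]
  | 0 => x
  | n + 1 => drinfeldOrbit q g Δ x n * drinfeldQuotient q g Δ (drinfeldOrbit q g Δ x n)

section

variable {F : Type*} [Field F] {q : ℕ} {g Δ : F[X]}

theorem mul_drinfeldQuotient (hq : 1 ≤ q) (s : F[X]) :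
    s * drinfeldQuotient q g Δ s = X * s + g * s ^ q + Δ * s ^ (q ^ 2) := by
  have h1 : s ^ q = s * s ^ (q - 1) := by rw [← pow_succ']; congr 1; omega
  have h2 : s ^ (q ^ 2) = s * s ^ (q ^ 2 - 1) := by
    rw [← pow_succ']; congr 1; have := Nat.one_le_pow 2 q hq; omega
  rw [drinfeldQuotient, h1, h2]
  ring

theorem drinfeldQuotient_eq (hq : 1 ≤ q) (s : F[X]) :
    drinfeldQuotient q g Δ s = X + s ^ (q - 1) * (g + Δ * s ^ (q ^ 2 - q)) := by
  have h : s ^ (q ^ 2 - 1) = s ^ (q - 1) * s ^ (q ^ 2 - q) := by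
    rw [← pow_add]; congr 1; have := Nat.le_self_pow two_ne_zero q; omega
  rw [drinfeldQuotient, h]
  ring

theorem eval_X_pow_eq_drinfeldOrbit (hq : 1 ≤ q) (φ : DrinfeldModule F)
    (hφ : φ X = C (algebraMap F[X] (RatFunc F) X) * X
      + C (algebraMap F[X] (RatFunc F) g) * X ^ q
      + C (algebraMap F[X] (RatFunc F) Δ) * X ^ (q ^ 2)) (x : F[X]) (n : ℕ) :
    (φ (X ^ n)).eval (algebraMap F[X] (RatFunc F) x)
      = algebraMap F[X] (RatFunc F) (drinfeldOrbit q g Δ x n) := by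
  induction n with
  | zero => rw [pow_zero, φ.map_one, eval_X, drinfeldOrbit]
  | succ n ih =>
    rw [φ.eval_X_pow_succ, ih, drinfeldOrbit, mul_drinfeldQuotient hq, hφ]
    simp

theorem drinfeldOrbit_dvd_succ (x : F[X]) (n : ℕ) :
    drinfeldOrbit q g Δ x n ∣ drinfeldOrbit q g Δ x (n + 1) :=
  Dvd.intro _ rfl

theorem drinfeldOrbit_dvd_of_le (x : F[X]) {m n : ℕ} (h : m ≤ n) :
    drinfeldOrbit q g Δ x m ∣ drinfeldOrbit q g Δ x n := by
  induction n, h using Nat.le_induction with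
  | base => exact dvd_rfl
  | succ n _ ih => exact ih.trans (drinfeldOrbit_dvd_succ x n)

/-! ### Powers of `T` as quotients -/

/-- A polynomial all of whose prime divisors divide `X` is a constant times a power of `X`. -/
theorem exists_eq_C_mul_X_pow {b : F[X]} (hb : b ≠ 0) (h : ∀ p, Prime p → p ∣ b → p ∣ X) :
    ∃ c k, c ≠ 0 ∧ b = C c * X ^ k := by
  obtain ⟨r, hr, hXr⟩ := exists_eq_pow_rootMultiplicity_mul_and_not_dvd b hb 0
  rw [C_0, sub_zero] at hr hXr
  have hr0 : r ≠ 0 := by rintro rfl; exact hXr (dvd_zero X)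
  have hunit : IsUnit r := by
    by_contra hu
    obtain ⟨p, hp, hpr⟩ := WfDvdMonoid.exists_irreducible_factor hu hr0
    have hpX := h p hp.prime (hr ▸ hpr.mul_left _)
    exact hXr (((hp.associated_of_dvd irreducible_X hpX).dvd_iff_dvd_left).1 hpr)
  obtain ⟨c, hc, rfl⟩ := isUnit_iff.1 hunit
  exact ⟨c, _, hc.ne_zero, hr.trans (mul_comm _ _)⟩

/-- If `g = -Δ a^(q^2-q)`, then `a ≠ φ_T(s)` for every `s ≠ 0` of smaller degree. With
`r = a / s` the relation `r = φ_T(s) / s` becomes `r - T = Δ s^(q^2-1) (1 - r^(q^2-q))`, whose right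
side has degree at least `2 deg r`. -/
theorem false_of_eq_neg_mul_pow (hq : 2 ≤ q) (hΔ : Δ ≠ 0) {s r : F[X]} (hs : s ≠ 0)
    (hr : 0 < r.natDegree) (hsr : r = drinfeldQuotient q g Δ s)
    (hg : g = -(Δ * (s * r) ^ (q ^ 2 - q))) : False := by
  have hqq : 2 ≤ q ^ 2 - q := by
    have : q * 2 ≤ q * q := Nat.mul_le_mul_left q hq
    rw [sq]; omega
  have key : r - X = Δ * s ^ (q - 1) * s ^ (q ^ 2 - q) * (1 - r ^ (q ^ 2 - q)) := by
    rw [drinfeldQuotient_eq (by omega), hg, mul_pow] at hsr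
    linear_combination hsr
  have hpow : (1 - r ^ (q ^ 2 - q)).natDegree = (q ^ 2 - q) * r.natDegree := by
    rw [natDegree_sub_eq_right_of_natDegree_lt, natDegree_pow]
    rw [natDegree_one, natDegree_pow]
    positivity
  have hne : 1 - r ^ (q ^ 2 - q) ≠ 0 := by
    intro h
    rw [h, natDegree_zero] at hpow
    have : 0 < (q ^ 2 - q) * r.natDegree := by positivity
    omega
  have hle : (r - X).natDegree ≤ r.natDegree :=
    (natDegree_sub_le _ _).trans (by rw [natDegree_X]; omega)
  rw [key, natDegree_mul (by positivity) hne, hpow] at hle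
  have : 2 * r.natDegree ≤ (q ^ 2 - q) * r.natDegree := Nat.mul_le_mul_right _ hqq
  omega

/-- Let `a = φ_T(s)`. If `φ_T(1)` is prime to `T`, then `T ∣ a` implies `T ∣ s`, and so
`T ^ 2 ∣ a`. -/
theorem X_sq_dvd_of_X_dvd [Finite F] (hq : q = Nat.card F) (hu : ¬ X ∣ X + g + Δ) {s : F[X]}
    (h : X ∣ s * drinfeldQuotient q g Δ s) : X ^ 2 ∣ s * drinfeldQuotient q g Δ s := by
  have hq2 : 2 ≤ q := hq ▸ Finite.one_lt_card
  have hXs : X ∣ s := by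
    -- Modulo `T` the map `s ↦ φ_T(s)` is multiplication by `φ_T(1)`, since `s(0)^q = s(0)`.
    have hfrob : s.eval 0 ^ q = s.eval 0 := by
      have := Fintype.ofFinite F
      rw [hq, Nat.card_eq_fintype_card, FiniteField.pow_card]
    rw [mul_drinfeldQuotient (by omega), X_dvd_iff, coeff_zero_eq_eval_zero] at h
    rw [X_dvd_iff, coeff_zero_eq_eval_zero] at hu ⊢
    simp only [eval_add, eval_mul, eval_X, eval_pow, sq q, pow_mul, hfrob, zero_mul,
      zero_add] at h hu
    rw [← add_mul] at h
    exact (mul_eq_zero.1 h).resolve_left hu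
  rw [sq]
  refine mul_dvd_mul hXs ?_
  rw [drinfeldQuotient_eq (by omega)]
  exact dvd_add dvd_rfl ((dvd_pow hXs (by omega)).mul_right _)

/-- The quotient `φ_T(a) / a` is not of the form `c T^k`, with `T ∣ a` in case `k ≠ 0`, if `a` is of
degree at least two and is itself a value `φ_T(s)` with `deg s < deg a`. -/
theorem drinfeldQuotient_ne_C_mul_X_pow [Finite F] (hq : q = Nat.card F) (hΔ : Δ ≠ 0)
    (hu : ¬ X ∣ X + g + Δ) {s a : F[X]} (ha : a = s * drinfeldQuotient q g Δ s)
    (hsa : s.natDegree < a.natDegree) (ha2 : 2 ≤ a.natDegree) {c : F} {k : ℕ}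
    (hXa : k ≠ 0 → X ∣ a) : drinfeldQuotient q g Δ a ≠ C c * X ^ k := by
  intro hb
  have hq2 : 2 ≤ q := hq ▸ Finite.one_lt_card
  have ha0 : a ≠ 0 := by rintro rfl; simp at ha2
  have hs0 : s ≠ 0 := by rintro rfl; simp [ha] at ha0
  rw [drinfeldQuotient_eq (by omega)] at hb
  have hb' : a ^ (q - 1) * (g + Δ * a ^ (q ^ 2 - q)) = C c * X ^ k - X := by
    linear_combination hb
  have hdvd : a ∣ C c * X ^ k - X :=
    hb' ▸ (dvd_pow_self a (by omega)).mul_right _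
  rcases lt_or_ge k 2 with hk | hk
  · have hzero : C c * X ^ k - X = 0 := by
      refine eq_zero_of_dvd_of_natDegree_lt hdvd (lt_of_le_of_lt ?_ ha2)
      refine (natDegree_sub_le _ _).trans (max_le ?_ natDegree_X_le)
      exact (natDegree_C_mul_X_pow_le c k).trans (by omega)
    rw [hzero] at hb'
    have hg := (mul_eq_zero.1 hb').resolve_left (pow_ne_zero _ ha0)
    have hr0 : drinfeldQuotient q g Δ s ≠ 0 := by
      intro h; rw [h, mul_zero] at ha; exact ha0 ha
    refine false_of_eq_neg_mul_pow hq2 hΔ hs0 ?_ rfl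
      (by rw [← ha]; exact eq_neg_of_add_eq_zero_left hg)
    have := natDegree_mul hs0 hr0
    rw [← ha] at this
    omega
  · have hX2 : X ^ 2 ∣ a := ha ▸ X_sq_dvd_of_X_dvd hq hu (ha ▸ hXa (by omega))
    have hXX : (X : F[X]) ^ 2 ∣ X := by
      have h := (((pow_dvd_pow X hk).mul_left (C c)).sub (hX2.trans hdvd))
      rwa [sub_sub_cancel] at h
    have := natDegree_le_of_dvd hXX X_ne_zero
    rw [natDegree_X_pow, natDegree_X] at this
    omega

/-! ### The Zsigmondy set -/

/-- If `φ_{T^(n+1)}(x)` has no primitive divisor, then `φ_{T^(n+1)}(x) / φ_{T^n}(x)` is a constant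
times a power of `T`, and `T` divides `φ_{T^n}(x)` if it divides this quotient. -/
theorem drinfeldQuotient_eq_of_no_primitive_divisor (hq : 2 ≤ q) {x : F[X]} {n : ℕ}
    (h0 : drinfeldOrbit q g Δ x (n + 1) ≠ 0)
    (h : ∀ p, Prime p → p ∣ drinfeldOrbit q g Δ x (n + 1) →
      ∃ i < n + 1, p ∣ drinfeldOrbit q g Δ x i) :
    ∃ c k, drinfeldQuotient q g Δ (drinfeldOrbit q g Δ x n) = C c * X ^ k ∧
      (k ≠ 0 → X ∣ drinfeldOrbit q g Δ x n) := by
  have hdvd : ∀ p, Prime p → p ∣ drinfeldQuotient q g Δ (drinfeldOrbit q g Δ x n) →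
      p ∣ drinfeldOrbit q g Δ x n := by
    intro p hp hpb
    obtain ⟨i, hi, hpi⟩ := h p hp (hpb.mul_left _)
    exact hpi.trans (drinfeldOrbit_dvd_of_le x (Nat.lt_succ_iff.1 hi))
  obtain ⟨c, k, -, hb⟩ := exists_eq_C_mul_X_pow (right_ne_zero_of_mul h0) fun p hp hpb => by
    have hpa := hdvd p hp hpb
    rw [drinfeldQuotient_eq (by omega)] at hpb
    exact (dvd_add_left ((dvd_pow hpa (by omega)).mul_right _)).1 hpb
  exact ⟨c, k, hb, fun hk => hdvd X prime_X (hb ▸ (dvd_pow_self X hk).mul_left _)⟩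

/-- The Zsigmondy set of a nontorsion polynomial point is contained in `{1, 2}`. -/
theorem le_two_of_mem_zsigmondySet [Finite F] (hq : q = Nat.card F) (φ : DrinfeldModule F)
    (hφ : φ X = C (algebraMap F[X] (RatFunc F) X) * X
      + C (algebraMap F[X] (RatFunc F) g) * X ^ q
      + C (algebraMap F[X] (RatFunc F) Δ) * X ^ (q ^ 2))
    (hΔ : Δ ≠ 0) (hu : ¬ X ∣ X + g + Δ) {x : F[X]}
    (hx : ¬ φ.IsTorsion (algebraMap F[X] (RatFunc F) x)) {n : ℕ}
    (hn : n ∈ φ.zsigmondySet (algebraMap F[X] (RatFunc F) x)) : n ≤ 2 := by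
  have hq2 : 2 ≤ q := hq ▸ Finite.one_lt_card
  have horb := eval_X_pow_eq_drinfeldOrbit (by omega) φ hφ x
  have hne : ∀ i, drinfeldOrbit q g Δ x i ≠ 0 := fun i h =>
    φ.eval_X_pow_ne_zero hx i (by rw [horb, h, _root_.map_zero])
  have hlt : ∀ i, (drinfeldOrbit q g Δ x i).natDegree
      < (drinfeldOrbit q g Δ x (i + 1)).natDegree := by
    intro i
    refine lt_of_le_of_ne (natDegree_le_of_dvd (drinfeldOrbit_dvd_succ x i) (hne _)) ?_
    intro hdeg
    have hmul := natDegree_mul (hne i) (right_ne_zero_of_mul (hne (i + 1)))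
    have hdeg' : (drinfeldOrbit q g Δ x i).natDegree = (drinfeldOrbit q g Δ x i *
      drinfeldQuotient q g Δ (drinfeldOrbit q g Δ x i)).natDegree := hdeg
    obtain ⟨c, hc⟩ := natDegree_eq_zero.1 (show (drinfeldQuotient q g Δ
      (drinfeldOrbit q g Δ x i)).natDegree = 0 by omega)
    have hc0 : c ≠ 0 := by
      rintro rfl
      exact right_ne_zero_of_mul (hne (i + 1)) (by rw [← hc, C_0])
    refine φ.eval_X_pow_succ_ne hx i hc0 ?_
    rw [horb, horb, ← _root_.map_mul, drinfeldOrbit, ← hc, mul_comm]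
  obtain ⟨-, hprim⟩ := hn
  by_contra! h3
  obtain ⟨m, rfl⟩ := Nat.exists_eq_add_of_le' h3
  obtain ⟨c, k, hb, hXa⟩ := drinfeldQuotient_eq_of_no_primitive_divisor hq2
    (hne (m + 2 + 1)) fun p hp hpa => by
      by_contra! hno
      refine hprim ⟨p, hp, ?_, fun i hi => ?_⟩
      · rwa [DrinfeldModule.numer, horb, RatFunc.num_algebraMap]
      · rw [DrinfeldModule.numer, horb, RatFunc.num_algebraMap]
        exact hno i hi
  have h0 := hlt m
  have h1 : (drinfeldOrbit q g Δ x (m + 1)).natDegree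
      < (drinfeldOrbit q g Δ x (m + 2)).natDegree := hlt (m + 1)
  exact drinfeldQuotient_ne_C_mul_X_pow hq hΔ hu (s := drinfeldOrbit q g Δ x (m + 1))
    (a := drinfeldOrbit q g Δ x (m + 2)) rfl h1 (by omega) hXa hb

end

/-- Here `T = X` in `F[X]`, `q` is the cardinality of `F`, and `u = φ_T(1)`. -/
theorem theorem1p1 {F : Type*} [Field F] [Finite F] (q : ℕ) (hq : q = Nat.card F)
    (φ : DrinfeldModule F) (hrank : φ.HasRank 2) (g Δ : F[X])
    (hφ : φ X = C (algebraMap F[X] (RatFunc F) X) * X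
      + C (algebraMap F[X] (RatFunc F) g) * X ^ q
      + C (algebraMap F[X] (RatFunc F) Δ) * X ^ (q ^ 2))
    (N : ℕ) (hN : N = lcmFactorDegrees Δ)
    (u : F[X]) (hu : (φ X).eval 1 = algebraMap F[X] (RatFunc F) u)
    (hcop : IsCoprime u (X * Δ))
    (S : Set (RatFuncPlace F)) (hS : S = placesDividingOrInfinite (X * Δ))
    (x : F[X]) (hx : ¬ φ.IsTorsion (algebraMap F[X] (RatFunc F) x)) :
    (φ.zsigmondySet (algebraMap F[X] (RatFunc F) x)).Finite ∧
      ∀ n ∈ φ.zsigmondySet (algebraMap F[X] (RatFunc F) x),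
        (n : ℝ) ≤ (6 * ((q : ℝ) ^ (2 * N) - 1) * N * S.ncard + 4)
          + 1 / 2 * Real.logb q (2 + 2 * g.natDegree + 2 * Δ.natDegree) := by
  have hq2 : 2 ≤ q := hq ▸ Finite.one_lt_card
  have hΔ : Δ ≠ 0 := by
    rintro rfl
    have hdeg : (φ X).natDegree ≤ q := by
      rw [hφ, _root_.map_zero, C_0, zero_mul, add_zero]
      refine (natDegree_add_le _ _).trans (max_le ?_ (natDegree_C_mul_X_pow_le _ _))
      exact (natDegree_C_mul_le _ _).trans (natDegree_X_le.trans (by omega))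
    rw [hrank, ← hq] at hdeg
    nlinarith
  have hu' : u = X + g + Δ := by
    apply RatFunc.algebraMap_injective F
    rw [← hu, hφ]
    simp
  have hXu : ¬ X ∣ X + g + Δ := fun h =>
    not_isUnit_X (hcop.of_mul_right_left.isUnit_of_dvd' (hu' ▸ h) dvd_rfl)
  have hle := fun n (hn : n ∈ φ.zsigmondySet (algebraMap F[X] (RatFunc F) x)) =>
    le_two_of_mem_zsigmondySet hq φ hφ hΔ hXu hx hn
  refine ⟨(Set.finite_Iic 2).subset hle, fun n hn => ?_⟩
  have hn2 : (n : ℝ) ≤ 2 := by exact_mod_cast hle n hn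
  have hqR : (1 : ℝ) < q := by exact_mod_cast hq2
  have hpow : (0 : ℝ) ≤ (q : ℝ) ^ (2 * N) - 1 := sub_nonneg.2 (one_le_pow₀ hqR.le)
  have hmain : (0 : ℝ) ≤ 6 * ((q : ℝ) ^ (2 * N) - 1) * N * S.ncard := by positivity
  have hlog : 0 ≤ Real.logb q (2 + 2 * g.natDegree + 2 * Δ.natDegree) := by
    refine Real.logb_nonneg hqR ?_
    have h1 : (0 : ℝ) ≤ g.natDegree := Nat.cast_nonneg _
    have h2 : (0 : ℝ) ≤ Δ.natDegree := Nat.cast_nonneg _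
    linarith
  linarith
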